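/- All registers are finite-dimensional quantum systems with fixed orthonormal bases, and $\log$ is to base $2$. For $\alpha\in(0,1)\cup(1,\infty)$, a density operator $\rho_{AB}$ and a density operator $\sigma_B$, put $$H_\alpha(A|B)_{\rho|\sigma}=\frac{1}{1-\alpha}\log\operatorname{Tr}\Big[\Big(\sigma_B^{\frac{1-\alpha}{2\alpha}}\rho_{AB}\,\sigma_B^{\frac{1-\alpha}{2\alpha}}\Big)^{\alpha}\Big]\quad\text{if } \operatorname{supp}\rho_{AB}\subseteq A\otimes\operatorname{supp}\sigma_B,$$ and $H_\alpha(A|B)_{\rho|\sigma}=-\infty$ otherwise (negative powers are taken on the support). The sandwiched conditional Rényi entropy is $H_\alpha(A|B)_\rho=\sup_{\sigma_B}H_\alpha(A|B)_{\rho|\sigma}$, the supremum running over all density operators $\sigma_B$ on $B$. Lemma. Let $\alpha\in[\tfrac12,1)\cup(1,\infty)$ and $n\in\mathbb N$. Let $Z^{\le n}$ be a register whose basis is indexed by the set $\{0,1\}^{\le n}$ of bit strings of length at most $n$, and let $R,\bar C,E^N$ be arbitrary registers. Let $\rho_{R\bar CE^N}$ and $\rho_{Z^{\le n}\bar CE^N}$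 be density operators that are classical in $\bar C$ (block-diagonal with respect to the basis $\{|\bar c\rangle\}$ of $\bar C$). For each value $\bar c$ let $R_{\bar c}$ be a subspace of $R$ that contains the support of the conditional state $\rho_{R|\bar C=\bar c}$ (no condition if $\bar c$ has probability $0$), and let $V^{(\bar c)}:R_{\bar c}\to Z^{\le n}$ be isometries such that $$V\rho_{R\bar CE^N}V^\dagger=\rho_{Z^{\le n}\bar CE^N},\qquad V=\sum_{\bar c}V^{(\bar c)}\otimes|\bar c\rangle\langle\bar c|_{\bar C}\otimes \mathbb I_{E^N}.$$ (The left-hand side is well defined, because $\rho_{R\bar CE^N}$ is supported on the subspace on which $V$ is defined.) Then $$H_\alpha(Z^{\le n}|\bar CE^N)_\rho=H_\alpha(R|\bar CE^N)_\rho .$$ -/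

import Mathlib

open scoped Matrix Kronecker ComplexOrder

noncomputable section

namespace RenyiInv

/-- Bit strings of length at most `n`, i.e. the set `{0,1}^{≤ n}`: a length `k ≤ n` together
with `k` bits. -/
abbrev BitStringLE (n : ℕ) : Type := Σ k : Fin (n + 1), (Fin (k : ℕ) → Bool)

/-- A normalized state (density matrix) on the register with orthonormal basis `ι`. -/
def IsState {ι : Type*} [Fintype ι] (ρ : Matrix ι ι ℂ) : Prop :=
  ρ.PosSemidef ∧ ρ.trace = 1

/-- The support of a Hermitian matrix: its range, which is the orthogonal complement of its
kernel. -/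
def supp {ι : Type*} [Fintype ι] [DecidableEq ι] (ρ : Matrix ι ι ℂ) :
    Submodule ℂ (EuclideanSpace ℂ ι) :=
  LinearMap.range (Matrix.toEuclideanLin ρ)

/-- The real power `M ^ s` of a positive semidefinite matrix by functional calculus on its
eigenvalues. For `s ≠ 0` one has `0 ^ s = 0`, so that negative powers are taken on the
support, as is the convention for states. -/
def mpow {ι : Type*} [Fintype ι] [DecidableEq ι] (M : Matrix ι ι ℂ) (s : ℝ) : Matrix ι ι ℂ :=
  cfc (fun x : ℝ => x ^ s) M

section Entropy

variable {A B : Type*} [Fintype A] [DecidableEq A] [Fintype B] [DecidableEq B]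

/-- The operator `σ_B^{(1-α)/(2α)} ρ_{AB} σ_B^{(1-α)/(2α)}`, where an operator on `B` acts on
`AB` as `1_A ⊗ ·`. -/
def sandwich (α : ℝ) (ρ : Matrix (A × B) (A × B) ℂ) (σ : Matrix B B ℂ) :
    Matrix (A × B) (A × B) ℂ :=
  ((1 : Matrix A A ℂ) ⊗ₖ mpow σ ((1 - α) / (2 * α))) * ρ *
    ((1 : Matrix A A ℂ) ⊗ₖ mpow σ ((1 - α) / (2 * α)))

open Classical in
/-- `H_α(A|B)_{ρ|σ}`. The range of `1_A ⊗ σ` is the space `A ⊗ supp σ`. -/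
def condRenyiGiven (α : ℝ) (ρ : Matrix (A × B) (A × B) ℂ) (σ : Matrix B B ℂ) : EReal :=
  if supp ρ ≤ supp ((1 : Matrix A A ℂ) ⊗ₖ σ) then
    ((1 / (1 - α) * Real.logb 2 (mpow (sandwich α ρ σ) α).trace.re : ℝ) : EReal)
  else ⊥

/-- The sandwiched conditional Rényi entropy `H_α(A|B)_ρ`, optimized over all states `σ` on
`B`. -/
def condRenyi (α : ℝ) (ρ : Matrix (A × B) (A × B) ℂ) : EReal :=
  ⨆ σ ∈ {σ : Matrix B B ℂ | IsState σ}, condRenyiGiven α ρ σ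

end Entropy

section Classical

variable {R C E Z : Type*}

/-- A state on registers `R C E` is classical in `C` (with respect to the fixed orthonormal
basis of `C`): `ρ = ∑ c, ρ_c ⊗ |c⟩⟨c|`. -/
def IsClassicalIn (ρ : Matrix (R × C × E) (R × C × E) ℂ) : Prop :=
  ∀ r c e r' c' e', c ≠ c' → ρ (r, c, e) (r', c', e') = 0

variable [Fintype R] [Fintype E]

/-- The operator `Tr_E ⟨c| ρ |c⟩` on `R`. -/
def condOp (ρ : Matrix (R × C × E) (R × C × E) ℂ) (c : C) : Matrix R R ℂ :=
  fun r r' => ∑ e, ρ (r, c, e) (r', c, e)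

/-- The probability of the value `c` on the register `C` (as a complex number). -/
def prob (ρ : Matrix (R × C × E) (R × C × E) ℂ) (c : C) : ℂ :=
  (condOp ρ c).trace

/-- The conditional state `ρ_{R | C = c}`, meaningful when `prob ρ c ≠ 0`. -/
def condState (ρ : Matrix (R × C × E) (R × C × E) ℂ) (c : C) : Matrix R R ℂ :=
  (prob ρ c)⁻¹ • condOp ρ c

/-- The matrix of an isometry `V : S → Z` from a subspace `S` of the register `R`, extended
by zero to the orthogonal complement of `S`. -/
def isoMatrix [DecidableEq R] [Fintype Z] {S : Submodule ℂ (EuclideanSpace ℂ R)}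
    (V : S →ₗᵢ[ℂ] EuclideanSpace ℂ Z) : Matrix Z R ℂ :=
  Matrix.toEuclideanLin.symm (V.toLinearMap ∘ₗ S.orthogonalProjectionOnto.toLinearMap)

/-- The operator `∑ c, V_c ⊗ |c⟩⟨c|`, tensored with the identity on `E`, where each isometry
`V_c` is extended by zero outside of its domain (this does not matter when it is applied to
operators supported on the domain). -/
def controlled [DecidableEq R] [Fintype Z] [Fintype C] [DecidableEq C] [DecidableEq E]
    {S : C → Submodule ℂ (EuclideanSpace ℂ R)}
    (V : ∀ c, S c →ₗᵢ[ℂ] EuclideanSpace ℂ Z) : Matrix (Z × C × E) (R × C × E) ℂ :=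
  ∑ c, isoMatrix (V c) ⊗ₖ (Matrix.single c c (1 : ℂ) ⊗ₖ (1 : Matrix E E ℂ))

end Classical

end RenyiInv

end

/-! If σ is block diagonal in C, the controlled isometry W intertwines `1 ⊗ σ` on both sides, since
W is diagonal in C and trivial on E. As WᴴW fixes ρ, conjugating ρ by W merely conjugates the
sandwich operator Y by W, and Tr f(WYWᴴ) = Tr f(Y) when f 0 = 0. So the two entropies agree for each
such σ (`condRenyiGiven_controlled_conj`).

It remains to see that such σ exhaust the supremum. With K = ρ^{1/2} and t = (1-α)/α, the trace
equals Tr (K σ^t K)^α (`trace_mpow_sandwich`). For α < 1, 0 < t ≤ 1: σ^t is operator concave and X ↦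
Tr X^α is monotone and concave. For α > 1, -1 < t < 0: σ^t is operator convex and Tr X^α is monotone
and convex. Given the sign of 1/(1-α), averaging σ with UσU, for a reflection U commuting with ρ,
never lowers the entropy (`condRenyiGiven_le_symmetrized`). Flipping the sign of one basis value of
C is such a reflection; averaging over these one by one removes all off-diagonal blocks of σ. -/

namespace RenyiInv

/-! ### Functional calculus and intertwining relations -/

open Polynomial in
/-- A single real polynomial represents the functional calculus of `f` at two Hermitian
matrices simultaneously. -/
theorem exists_polynomial_cfc {m n : Type*} [Fintype m] [DecidableEq m] [Fintype n]
    [DecidableEq n] {M : Matrix m m ℂ} {N : Matrix n n ℂ} (hM : M.IsHermitian)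
    (hN : N.IsHermitian) (f : ℝ → ℝ) :
    ∃ p : ℝ[X], aeval M p = cfc f M ∧ aeval N p = cfc f N := by
  have h1 : (spectrum ℝ M).Finite := by
    rw [hM.spectrum_real_eq_range_eigenvalues]; exact Set.finite_range _
  have h2 : (spectrum ℝ N).Finite := by
    rw [hN.spectrum_real_eq_range_eigenvalues]; exact Set.finite_range _
  -- Both spectra are finite, so interpolating f on their union serves both matrices.
  set F := (h1.union h2).toFinset
  have key : ∀ x ∈ spectrum ℝ M ∪ spectrum ℝ N, (Lagrange.interpolate F id f).eval x = f x := by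
    intro x hx
    have hxF : x ∈ F := by simpa [F] using hx
    simpa using Lagrange.eval_interpolate_at_node f (Set.injOn_id _) hxF
  refine ⟨Lagrange.interpolate F id f, ?_, ?_⟩
  · rw [← cfc_polynomial _ M hM.isSelfAdjoint]
    exact cfc_congr fun x hx => key x (Or.inl hx)
  · rw [← cfc_polynomial _ N hN.isSelfAdjoint]
    exact cfc_congr fun x hx => key x (Or.inr hx)

open Polynomial in
theorem aeval_mul_of_intertwine {m n : Type*} [Fintype m] [DecidableEq m] [Fintype n]
    [DecidableEq n] {M : Matrix m m ℂ} {N : Matrix n n ℂ} {A : Matrix m n ℂ}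
    (h : M * A = A * N) (p : ℝ[X]) : aeval M p * A = A * aeval N p := by
  induction p using Polynomial.induction_on' with
  | add p q hp hq => simp [Matrix.add_mul, Matrix.mul_add, hp, hq]
  | monomial k a =>
    have : M ^ k * A = A * N ^ k := by
      induction k with
      | zero => simp
      | succ k ih => rw [pow_succ, Matrix.mul_assoc, h, ← Matrix.mul_assoc, ih, Matrix.mul_assoc,
          ← pow_succ]
    simp [aeval_monomial, Algebra.algebraMap_eq_smul_one, this]

/-- The functional calculus respects intertwining relations between Hermitian matrices. -/
theorem cfc_mul_of_intertwine {m n : Type*} [Fintype m] [DecidableEq m] [Fintype n]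
    [DecidableEq n] {M : Matrix m m ℂ} {N : Matrix n n ℂ} (hM : M.IsHermitian)
    (hN : N.IsHermitian) {A : Matrix m n ℂ} (h : M * A = A * N) (f : ℝ → ℝ) :
    cfc f M * A = A * cfc f N := by
  obtain ⟨p, h1, h2⟩ := exists_polynomial_cfc hM hN f
  rw [← h1, ← h2, aeval_mul_of_intertwine h]

theorem continuousOn_spectrum {n : Type*} [Fintype n] [DecidableEq n] {M : Matrix n n ℂ}
    (hM : M.IsHermitian) (f : ℝ → ℝ) : ContinuousOn f (spectrum ℝ M) := by
  have : (spectrum ℝ M).Finite := by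
    rw [hM.spectrum_real_eq_range_eigenvalues]; exact Set.finite_range _
  exact this.continuousOn f

/-- Splitting off a factor M makes cyclicity of the trace applicable to Tr f(M). -/
theorem cfc_eq_mul_cfc_div {n : Type*} [Fintype n] [DecidableEq n] {M : Matrix n n ℂ}
    (hM : M.IsHermitian) {f : ℝ → ℝ} (hf : f 0 = 0) :
    cfc f M = M * cfc (fun x => f x / x) M := by
  have hfac : ∀ x : ℝ, f x = x * (f x / x) := by
    intro x
    rcases eq_or_ne x 0 with rfl | hx
    · simp [hf]
    · field_simp
  conv_lhs => rw [show f = fun x => x * (f x / x) from funext hfac]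
  rw [cfc_mul (fun x => x) (fun x => f x / x) M (continuousOn_spectrum hM _)
    (continuousOn_spectrum hM _), cfc_id' ℝ M hM.isSelfAdjoint]

/-- `Tr f(AB) = Tr f(BA)` if `f 0 = 0`. -/
theorem trace_cfc_mul_comm {m n : Type*} [Fintype m] [DecidableEq m] [Fintype n]
    [DecidableEq n] {A : Matrix m n ℂ} {B : Matrix n m ℂ} (hAB : (A * B).IsHermitian)
    (hBA : (B * A).IsHermitian) {f : ℝ → ℝ} (hf : f 0 = 0) :
    (cfc f (A * B)).trace = (cfc f (B * A)).trace := by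
  -- With g(x) = f(x)/x: Tr AB g(AB) = Tr B g(AB) A = Tr BA g(BA).
  rw [cfc_eq_mul_cfc_div hAB hf, cfc_eq_mul_cfc_div hBA hf, Matrix.mul_assoc, Matrix.trace_mul_comm, Matrix.mul_assoc,
    cfc_mul_of_intertwine hAB hBA (Matrix.mul_assoc A B A), ← Matrix.mul_assoc]

theorem diag_re_mono {n : Type*} [Fintype n] {A B : Matrix n n ℂ} (h : (B - A).PosSemidef) (U : Matrix n n ℂ) (i : n) :
    ((Uᴴ * A * U) i i).re ≤ ((Uᴴ * B * U) i i).re := by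
  have := (h.conjTranspose_mul_mul_same U).diag_nonneg (i := i)
  rw [Matrix.mul_sub, Matrix.sub_mul, Matrix.sub_apply] at this
  simpa using (Complex.nonneg_iff.mp this).1

theorem trace_re_mono {n : Type*} [Fintype n] {A B : Matrix n n ℂ} (h : (B - A).PosSemidef) : A.trace.re ≤ B.trace.re := by
  have := (Complex.nonneg_iff.mp h.trace_nonneg).1
  rw [Matrix.trace_sub, Complex.sub_re] at this
  linarith

/-! ### Real powers of positive semidefinite matrices -/

section mpow

variable {n : Type*} [Fintype n] [DecidableEq n] {σ : Matrix n n ℂ}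

theorem spectrum_nonneg (hσ : σ.PosSemidef) {x : ℝ} (hx : x ∈ spectrum ℝ σ) : 0 ≤ x := by
  rw [hσ.1.spectrum_real_eq_range_eigenvalues] at hx
  obtain ⟨i, rfl⟩ := hx
  exact hσ.eigenvalues_nonneg i

open scoped MatrixOrder in
theorem mpow_posSemidef (hσ : σ.PosSemidef) (s : ℝ) : (mpow σ s).PosSemidef := by
  rw [← Matrix.nonneg_iff_posSemidef]
  exact cfc_nonneg fun x hx => Real.rpow_nonneg (spectrum_nonneg hσ hx) s

theorem mpow_one (hσ : σ.PosSemidef) : mpow σ 1 = σ := by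
  simp only [mpow, Real.rpow_one]
  exact cfc_id' ℝ σ hσ.1.isSelfAdjoint

/-- Since `0 ^ 0 = 1`, the exponents are restricted so that both sides vanish on the kernel of σ. -/
theorem mpow_mul_mpow (hσ : σ.PosSemidef) {s t : ℝ} (hs : s ≠ 0) (hst : s + t ≠ 0) :
    mpow σ s * mpow σ t = mpow σ (s + t) := by
  unfold mpow
  rw [← cfc_mul _ _ σ (continuousOn_spectrum hσ.1 _) (continuousOn_spectrum hσ.1 _)]
  refine cfc_congr fun x hx => ?_
  rcases (spectrum_nonneg hσ hx).eq_or_lt with rfl | h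
  · simp [Real.zero_rpow hs, Real.zero_rpow hst]
  · simp [Real.rpow_add h]

theorem mpow_half_mul_self (hσ : σ.PosSemidef) : mpow σ (1 / 2) * mpow σ (1 / 2) = σ := by
  rw [mpow_mul_mpow hσ (by norm_num) (by norm_num)]
  norm_num [mpow_one hσ]

/-- The last factor σ kills the kernel, the only place where σ^t σ^{-t} may differ from the
identity. -/
theorem mpow_mul_mpow_neg_mul_self (hσ : σ.PosSemidef) (t : ℝ) :
    mpow σ t * mpow σ (-t) * σ = σ := by
  have hid := cfc_id' ℝ σ hσ.1.isSelfAdjoint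
  have h : cfc (fun x : ℝ => x ^ t * x ^ (-t) * x) σ = mpow σ t * mpow σ (-t) * σ := by
    rw [cfc_mul (fun x : ℝ => x ^ t * x ^ (-t)) (fun x => x) σ (continuousOn_spectrum hσ.1 _)
      (continuousOn_spectrum hσ.1 _), cfc_mul (fun x : ℝ => x ^ t) (fun x : ℝ => x ^ (-t)) σ
      (continuousOn_spectrum hσ.1 _) (continuousOn_spectrum hσ.1 _), hid]
    rfl
  rw [← h]
  conv_rhs => rw [← hid]
  refine cfc_congr fun x hx => ?_
  rcases (spectrum_nonneg hσ hx).eq_or_lt with rfl | h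
  · simp
  · simp [← Real.rpow_add h]

theorem mpow_mul_of_intertwine {m : Type*} [Fintype m] [DecidableEq m] {τ : Matrix m m ℂ}
    {A : Matrix m n ℂ} (hτ : τ.PosSemidef) (hσ : σ.PosSemidef) (h : τ * A = A * σ) (s : ℝ) :
    mpow τ s * A = A * mpow σ s :=
  cfc_mul_of_intertwine hτ.1 hσ.1 h _

/-- Functional calculus commutes with conjugation by a self-inverse Hermitian matrix. -/
theorem mpow_conj {U : Matrix n n ℂ} (hU : Uᴴ = U) (hUU : U * U = 1) (hσ : σ.PosSemidef) (s : ℝ) :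
    mpow (U * σ * U) s = U * mpow σ s * U := by
  have h1 : (U * σ * U).PosSemidef := by
    simpa [hU] using hσ.mul_mul_conjTranspose_same U
  have h2 := mpow_mul_of_intertwine (A := U) h1 hσ
    (by rw [Matrix.mul_assoc, hUU, Matrix.mul_one]) s
  rw [← h2, Matrix.mul_assoc (mpow _ _), hUU, Matrix.mul_one]

-- Gives access to the Löwner–Heinz theorem: operator monotonicity and concavity of x^t for 0 ≤ t ≤
-- 1.
open scoped MatrixOrder Matrix.Norms.L2Operator in
theorem mpow_eq_rpow (hσ : σ.PosSemidef) (s : ℝ) : mpow σ s = σ ^ s :=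
  (CFC.rpow_eq_cfc_real hσ.nonneg).symm

open scoped MatrixOrder Matrix.Norms.L2Operator in
theorem mpow_mono {τ : Matrix n n ℂ} (hσ : σ.PosSemidef) (hτ : τ.PosSemidef)
    (h : (τ - σ).PosSemidef) {t : ℝ} (h0 : 0 ≤ t) (h1 : t ≤ 1) :
    (mpow τ t - mpow σ t).PosSemidef := by
  rw [mpow_eq_rpow hσ, mpow_eq_rpow hτ]
  exact CFC.rpow_le_rpow ⟨h0, h1⟩ (Matrix.le_iff.mpr h)

open scoped MatrixOrder Matrix.Norms.L2Operator in
theorem mpow_midpoint_concave {τ : Matrix n n ℂ} (hσ : σ.PosSemidef) (hτ : τ.PosSemidef)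
    {t : ℝ} (h0 : 0 ≤ t) (h1 : t ≤ 1) :
    (mpow ((1 / 2 : ℝ) • (σ + τ)) t - (1 / 2 : ℝ) • (mpow σ t + mpow τ t)).PosSemidef := by
  have hsum : ((1 / 2 : ℝ) • (σ + τ)).PosSemidef := (hσ.add hτ).smul (by norm_num)
  have := (CFC.concaveOn_rpow (A := Matrix n n ℂ) (p := t) ⟨h0, h1⟩).2 (Set.mem_Ici.mpr hσ.nonneg)
    (Set.mem_Ici.mpr hτ.nonneg) (show (0 : ℝ) ≤ 1 / 2 by norm_num)
    (show (0 : ℝ) ≤ 1 / 2 by norm_num) (by norm_num)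
  rw [mpow_eq_rpow hσ, mpow_eq_rpow hτ, mpow_eq_rpow hsum, smul_add, smul_add]
  exact Matrix.le_iff.mp this

theorem trace_mpow_eq_sum (hσ : σ.PosSemidef) (s : ℝ) :
    (mpow σ s).trace.re = ∑ i, hσ.1.eigenvalues i ^ s := by
  unfold mpow
  rw [hσ.1.cfc_eq, Matrix.IsHermitian.cfc, Unitary.conjStarAlgAut_apply, Matrix.trace_mul_comm,
    ← Matrix.mul_assoc]
  simp [Matrix.trace]

theorem trace_mpow_re_pos (hσ : σ.PosSemidef) (h : σ ≠ 0) (s : ℝ) : 0 < (mpow σ s).trace.re := by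
  rw [trace_mpow_eq_sum hσ]
  have : ∃ i, hσ.1.eigenvalues i ≠ 0 := by
    by_contra! hc
    exact h (hσ.1.eigenvalues_eq_zero_iff.mp (funext hc))
  obtain ⟨i, hi⟩ := this
  exact Finset.sum_pos' (fun j _ => Real.rpow_nonneg (hσ.eigenvalues_nonneg j) s)
    ⟨i, Finset.mem_univ _, Real.rpow_pos_of_pos ((hσ.eigenvalues_nonneg i).lt_of_ne' hi) s⟩

/-- Bernoulli's inequality at x/c - 1, scaled by c^p: a convex function lies above its tangent at c.
-/
theorem tangent_le_rpow {x c p : ℝ} (hx : 0 ≤ x) (hc : 0 < c) (hp : 1 ≤ p) :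
    c ^ p * (1 - p) + p * c ^ (p - 1) * x ≤ x ^ p := by
  have h := one_add_mul_self_le_rpow_one_add (s := x / c - 1) (by linarith [div_nonneg hx hc.le]) hp
  have h2 := mul_le_mul_of_nonneg_left h (Real.rpow_nonneg hc.le p)
  rw [add_sub_cancel, Real.div_rpow hx hc.le, mul_div_cancel₀ _ (Real.rpow_pos_of_pos hc p).ne']
    at h2
  refine le_trans (le_of_eq ?_) h2
  rw [Real.rpow_sub_one hc.ne']
  field_simp
  ring

open scoped MatrixOrder in
theorem tangent_le_mpow (hσ : σ.PosSemidef) {c p : ℝ} (hc : 0 < c) (hp : 1 ≤ p) :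
    (mpow σ p - ((c ^ p * (1 - p)) • (1 : Matrix n n ℂ) + (p * c ^ (p - 1)) • σ)).PosSemidef := by
  have h : cfc (fun x : ℝ => c ^ p * (1 - p) + p * c ^ (p - 1) * x) σ =
      (c ^ p * (1 - p)) • (1 : Matrix n n ℂ) + (p * c ^ (p - 1)) • σ := by
    rw [cfc_add (a := σ) (fun _ : ℝ => c ^ p * (1 - p)) (fun x : ℝ => p * c ^ (p - 1) * x)
      (continuousOn_spectrum hσ.1 _) (continuousOn_spectrum hσ.1 _), cfc_const _ σ hσ.1.isSelfAdjoint,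
      cfc_const_mul _ (fun x => x) σ (continuousOn_spectrum hσ.1 _), cfc_id' ℝ σ hσ.1.isSelfAdjoint,
      Algebra.algebraMap_eq_smul_one]
  rw [← h, ← Matrix.le_iff]
  exact cfc_mono (fun x hx => tangent_le_rpow (spectrum_nonneg hσ hx) hc hp)
    (continuousOn_spectrum hσ.1 _) (continuousOn_spectrum hσ.1 _)

/-- Monotonicity and midpoint convexity of `X ↦ Tr X ^ p` for `p ≥ 1`. -/
theorem trace_mpow_le_of_le_midpoint {Y X₁ X₂ : Matrix n n ℂ} (hY : Y.PosSemidef)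
    (h₁ : X₁.PosSemidef) (h₂ : X₂.PosSemidef)
    (h : ((1 / 2 : ℝ) • (X₁ + X₂) - Y).PosSemidef) {p : ℝ} (hp : 1 ≤ p) :
    (mpow Y p).trace.re ≤ ((mpow X₁ p).trace.re + (mpow X₂ p).trace.re) / 2 := by
  -- For p > 1 the power need not be operator monotone, so only diagonal entries in an eigenbasis of
  -- Y are compared, using the tangent to x^p at each eigenvalue of Y.
  set U : Matrix n n ℂ := hY.1.eigenvectorUnitary.1
  have hUU : U * Uᴴ = 1 := Unitary.coe_mul_star_self hY.1.eigenvectorUnitary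
  have hUU' : Uᴴ * U = 1 := Unitary.coe_star_mul_self hY.1.eigenvectorUnitary
  have htr : ∀ M : Matrix n n ℂ, M.trace.re = ∑ i, ((Uᴴ * M * U) i i).re := by
    intro M
    have : M.trace = (Uᴴ * M * U).trace := by
      rw [Matrix.trace_mul_comm, ← Matrix.mul_assoc, hUU, Matrix.one_mul]
    rw [this, Matrix.trace, Complex.re_sum]; rfl
  have hdiag : ∀ i, ((Uᴴ * Y * U) i i).re = hY.1.eigenvalues i := by
    intro i
    have h3 := hY.1.conjStarAlgAut_star_eigenvectorUnitary
    rw [Unitary.conjStarAlgAut_star_apply] at h3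
    change ((Uᴴ * Y * U) i i).re = _
    have h4 : Uᴴ * Y * U = _ := h3
    rw [h4]; simp
  have hpt : ∀ {X : Matrix n n ℂ}, X.PosSemidef → ∀ i, 0 < hY.1.eigenvalues i →
      hY.1.eigenvalues i ^ p * (1 - p) + p * hY.1.eigenvalues i ^ (p - 1) * ((Uᴴ * X * U) i i).re ≤
        ((Uᴴ * mpow X p * U) i i).re := by
    intro X hX i hc
    have := diag_re_mono (tangent_le_mpow hX hc hp) U i
    refine le_trans (le_of_eq ?_) this
    simp [Matrix.mul_add, Matrix.add_mul, hUU']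
  rw [htr (mpow X₁ p), htr (mpow X₂ p), trace_mpow_eq_sum hY, ← Finset.sum_add_distrib,
    Finset.sum_div]
  refine Finset.sum_le_sum fun i _ => ?_
  -- The tangent is available only at c > 0; at a zero eigenvalue the left side is 0.
  rcases (hY.eigenvalues_nonneg i).eq_or_lt with h0 | hc
  · rw [← h0, Real.zero_rpow (by linarith)]
    have e1 := (mpow_posSemidef h₁ p).conjTranspose_mul_mul_same U |>.diag_nonneg (i := i)
    have e2 := (mpow_posSemidef h₂ p).conjTranspose_mul_mul_same U |>.diag_nonneg (i := i)
    have e1 := (Complex.nonneg_iff.mp e1).1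
    have e2 := (Complex.nonneg_iff.mp e2).1
    linarith
  · have e1 := hpt h₁ i hc
    have e2 := hpt h₂ i hc
    have e3 := diag_re_mono h U i
    rw [hdiag] at e3
    simp only [Matrix.mul_add, Matrix.add_mul, Matrix.mul_smul, Matrix.smul_mul, Matrix.smul_apply,
      Matrix.add_apply, Complex.real_smul, Complex.add_re,
      Complex.re_ofReal_mul] at e3
    set c := hY.1.eigenvalues i
    have hcp : 0 ≤ p * c ^ (p - 1) := mul_nonneg (by linarith) (Real.rpow_nonneg hc.le _)
    have e4 := mul_le_mul_of_nonneg_left e3 hcp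
    have e5 : p * c ^ (p - 1) * c = p * c ^ p := by
      rw [Real.rpow_sub_one hc.ne']; field_simp
    linarith

/-- Monotonicity and midpoint concavity of `X ↦ Tr X ^ p` for `0 ≤ p ≤ 1`. -/
theorem le_trace_mpow_of_midpoint_le {Y X₁ X₂ : Matrix n n ℂ} (hY : Y.PosSemidef)
    (h₁ : X₁.PosSemidef) (h₂ : X₂.PosSemidef)
    (h : (Y - (1 / 2 : ℝ) • (X₁ + X₂)).PosSemidef) {p : ℝ} (hp0 : 0 ≤ p) (hp : p ≤ 1) :
    ((mpow X₁ p).trace.re + (mpow X₂ p).trace.re) / 2 ≤ (mpow Y p).trace.re := by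
  have hM : ((1 / 2 : ℝ) • (X₁ + X₂)).PosSemidef := (h₁.add h₂).smul (by norm_num)
  have e1 := trace_re_mono (mpow_mono hM hY h hp0 hp)
  have e2 := trace_re_mono (mpow_midpoint_concave h₁ h₂ hp0 hp)
  refine le_trans (le_trans (le_of_eq ?_) e2) e1
  simp [Matrix.trace_smul, Matrix.trace_add]
  ring

end mpow

/-! ### Compressions, pseudoinverses and supports -/

/-- If `A ≥ 0` and `Pᴴ A P = 0`, then `A P = 0`. -/
theorem mul_eq_zero_of_conj_eq_zero {m n : Type*} [Fintype m] [Fintype n]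
    {A : Matrix n n ℂ} (hA : A.PosSemidef) {P : Matrix n m ℂ} (h : Pᴴ * A * P = 0) : A * P = 0 := by
  classical
  obtain ⟨B, rfl⟩ : ∃ B : Matrix n n ℂ, A = Bᴴ * B := by
    refine ⟨mpow A (1 / 2), ?_⟩
    rw [(mpow_posSemidef hA _).1.eq, mpow_half_mul_self hA]
  have : (B * P)ᴴ * (B * P) = 0 := by
    rw [Matrix.conjTranspose_mul, ← h]; simp only [Matrix.mul_assoc]
  rw [Matrix.conjTranspose_mul_self_eq_zero] at this
  rw [Matrix.mul_assoc, this, Matrix.mul_zero]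

/-- Midpoint convexity of `τ ↦ Kᴴ τ⁻¹ K`, with `J` in the role of the inverse of `τ` on the range
of `K`. -/
theorem conj_pseudoinverse_midpoint_convex {m n : Type*} [Fintype m] [Fintype n]
    {τ₁ τ₂ τ J₁ J₂ J : Matrix n n ℂ} {K : Matrix n m ℂ} (h₁ : τ₁.PosSemidef) (h₂ : τ₂.PosSemidef)
    (hJ₁ : J₁.IsHermitian) (hJ₂ : J₂.IsHermitian) (hJ : J.IsHermitian)
    (e₁ : τ₁ * (J₁ * K) = K) (e₂ : τ₂ * (J₂ * K) = K) (e : τ * (J * K) = K)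
    (h : (τ - (1 / 2 : ℝ) • (τ₁ + τ₂)).PosSemidef) :
    ((1 / 2 : ℝ) • (Kᴴ * J₁ * K + Kᴴ * J₂ * K) - Kᴴ * J * K).PosSemidef := by
  -- Completing the square: the positive forms of τ₁ and τ₂ at J₁K - JK and J₂K - JK, averaged, plus
  -- that of τ - (τ₁ + τ₂)/2 at JK, give the claim.
  have key : ∀ {τ' J' : Matrix n n ℂ}, τ'.IsHermitian → J'.IsHermitian → τ' * (J' * K) = K →
      (J' * K - J * K)ᴴ * τ' * (J' * K - J * K) =
        Kᴴ * J' * K - (2 : ℝ) • (Kᴴ * J * K) + (J * K)ᴴ * τ' * (J * K) := by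
    intro τ' J' hτ' hJ' e'
    have e'' : Kᴴ * J' * τ' = Kᴴ := by
      have := congrArg Matrix.conjTranspose e'
      rwa [Matrix.conjTranspose_mul, Matrix.conjTranspose_mul, hJ'.eq, hτ'.eq] at this
    rw [Matrix.conjTranspose_sub, Matrix.conjTranspose_mul, Matrix.conjTranspose_mul, hJ'.eq,
      hJ.eq, Matrix.sub_mul, e'', Matrix.sub_mul, Matrix.mul_sub, Matrix.mul_sub,
      Matrix.mul_assoc _ τ' (J' * K), e', two_smul]
    simp only [Matrix.mul_assoc]
    abel
  have hJτJ : (J * K)ᴴ * τ * (J * K) = Kᴴ * J * K := by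
    rw [Matrix.mul_assoc, e, Matrix.conjTranspose_mul, hJ.eq]
  have p₁ := h₁.conjTranspose_mul_mul_same (J₁ * K - J * K)
  have p₂ := h₂.conjTranspose_mul_mul_same (J₂ * K - J * K)
  have p := h.conjTranspose_mul_mul_same (J * K)
  rw [key h₁.1 hJ₁ e₁] at p₁
  rw [key h₂.1 hJ₂ e₂] at p₂
  rw [Matrix.mul_sub, Matrix.sub_mul, hJτJ] at p
  have q := ((p₁.add p₂).smul (show (0 : ℝ) ≤ 1 / 2 by norm_num)).add p
  convert q using 1
  simp only [Matrix.mul_add, Matrix.add_mul, Matrix.mul_smul, Matrix.smul_mul]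
  module

section supp

variable {n : Type*} [Fintype n] [DecidableEq n]

/-- Solving for N column by column turns support conditions into matrix identities. -/
theorem supp_le_iff {ρ T : Matrix n n ℂ} : supp ρ ≤ supp T ↔ ∃ N : Matrix n n ℂ, ρ = T * N := by
  constructor
  · intro h
    have : ∀ j, ∃ v : n → ℂ, T *ᵥ v = ρ *ᵥ Pi.single j 1 := by
      intro j
      have hj : Matrix.toEuclideanLin ρ (WithLp.toLp 2 (Pi.single j 1)) ∈ supp T :=
        h (LinearMap.mem_range_self _ _)
      obtain ⟨v, hv⟩ := hj
      refine ⟨v.ofLp, ?_⟩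
      simpa [Matrix.toLpLin_apply] using congrArg WithLp.ofLp hv
    choose v hv using this
    refine ⟨Matrix.of fun i j => v j i, ?_⟩
    ext i j
    have := congrFun (hv j) i
    rw [Matrix.mulVec_single_one] at this
    rw [Matrix.mul_apply]
    exact this.symm
  · rintro ⟨N, rfl⟩
    rintro _ ⟨v, rfl⟩
    refine ⟨WithLp.toLp 2 (N *ᵥ v.ofLp), ?_⟩
    simp [Matrix.toLpLin_apply]

/-- If `0 ≤ A ≤ c B`, then the range of `A` is contained in the range of `B`. -/
theorem exists_eq_mul_of_le_smul {A B : Matrix n n ℂ} (hA : A.PosSemidef) (hB : B.PosSemidef)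
    {c : ℝ} (h : (c • B - A).PosSemidef) : ∃ N, A = B * N := by
  have hJ := mpow_posSemidef hB (-1)
  have e := mpow_mul_mpow_neg_mul_self hB 1
  rw [mpow_one hB] at e
  set J := mpow B (-1)
  -- P projects onto the kernel of B, so 0 ≤ PᴴAP ≤ c PᴴBP = 0.
  set P : Matrix n n ℂ := 1 - J * B
  have hBP : B * P = 0 := by
    rw [Matrix.mul_sub, Matrix.mul_one, ← Matrix.mul_assoc, e, sub_self]
  have h0 : Pᴴ * A * P = 0 := by
    have h1 := hA.conjTranspose_mul_mul_same P
    have h2 := h.conjTranspose_mul_mul_same P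
    rw [Matrix.mul_sub Pᴴ, Matrix.sub_mul (Pᴴ * _), Matrix.mul_smul, Matrix.smul_mul,
      Matrix.mul_assoc _ B,
      hBP, Matrix.mul_zero, smul_zero, zero_sub] at h2
    open scoped MatrixOrder in
    exact le_antisymm (neg_nonneg.mp h2.nonneg) h1.nonneg
  have h3 := mul_eq_zero_of_conj_eq_zero hA h0
  refine ⟨J * A, ?_⟩
  have h4 := congrArg Matrix.conjTranspose h3
  simp only [P, Matrix.conjTranspose_mul, Matrix.conjTranspose_sub, Matrix.conjTranspose_one,
    hA.1.eq, hB.1.eq, hJ.1.eq, Matrix.conjTranspose_zero, Matrix.sub_mul, Matrix.one_mul] at h4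
  rw [← Matrix.mul_assoc]
  exact sub_eq_zero.mp h4

end supp

theorem one_kronecker_mul {A B : Type*} [Fintype A] [DecidableEq A] [Fintype B]
    (X Y : Matrix B B ℂ) :
    (1 : Matrix A A ℂ) ⊗ₖ (X * Y) = ((1 : Matrix A A ℂ) ⊗ₖ X) * ((1 : Matrix A A ℂ) ⊗ₖ Y) := by
  rw [← Matrix.mul_kronecker_mul, Matrix.one_mul]

theorem one_kronecker_posSemidef {A B : Type*} [Fintype A] [DecidableEq A] [Fintype B]
    {X : Matrix B B ℂ} (hX : X.PosSemidef) :
    ((1 : Matrix A A ℂ) ⊗ₖ X).PosSemidef :=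
  Matrix.PosSemidef.one.kronecker hX

/-! ### The trace functional and averaging over a symmetry -/

section Entropy

variable {A B : Type*} [Fintype A] [DecidableEq A] [Fintype B] [DecidableEq B]

variable {α : ℝ} {ρ : Matrix (A × B) (A × B) ℂ} {σ : Matrix B B ℂ}

theorem sandwich_posSemidef (hρ : ρ.PosSemidef) (hσ : σ.PosSemidef) :
    (sandwich α ρ σ).PosSemidef := by
  have h := (one_kronecker_posSemidef (A := A)
    (mpow_posSemidef hσ ((1 - α) / (2 * α))))
  have := hρ.mul_mul_conjTranspose_same
    ((1 : Matrix A A ℂ) ⊗ₖ mpow σ ((1 - α) / (2 * α)))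
  rwa [h.1.eq] at this

theorem sqrt_conj_posSemidef (hρ : ρ.PosSemidef) (hσ : σ.PosSemidef) (t : ℝ) :
    (mpow ρ (1 / 2) * ((1 : Matrix A A ℂ) ⊗ₖ mpow σ t) * mpow ρ (1 / 2)).PosSemidef := by
  have := (one_kronecker_posSemidef (A := A) (mpow_posSemidef hσ t)).mul_mul_conjTranspose_same
    (mpow ρ (1 / 2))
  rwa [(mpow_posSemidef hρ _).1.eq] at this

/-- The trace in the sandwiched entropy, rewritten so that `σ` occurs only once. -/
theorem trace_mpow_sandwich (hα0 : 0 < α) (hα1 : α ≠ 1) (hρ : ρ.PosSemidef) (hσ : σ.PosSemidef) :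
    (mpow (sandwich α ρ σ) α).trace =
      (mpow (mpow ρ (1 / 2) * ((1 : Matrix A A ℂ) ⊗ₖ mpow σ ((1 - α) / α)) * mpow ρ (1 / 2))
        α).trace := by
  have hs : (1 - α) / (2 * α) ≠ 0 := div_ne_zero (sub_ne_zero.mpr hα1.symm) (by positivity)
  have hss : (1 - α) / (2 * α) + (1 - α) / (2 * α) = (1 - α) / α := by field_simp; ring
  have hs2 : (1 - α) / α ≠ 0 := div_ne_zero (sub_ne_zero.mpr hα1.symm) hα0.ne'
  set S := (1 : Matrix A A ℂ) ⊗ₖ mpow σ ((1 - α) / (2 * α)) with hS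
  set K := mpow ρ (1 / 2)
  -- The two operators are XXᴴ and XᴴX for X = SK.
  have e1 : sandwich α ρ σ = (S * K) * (K * S) := by
    rw [Matrix.mul_assoc, ← Matrix.mul_assoc K, mpow_half_mul_self hρ, ← Matrix.mul_assoc]; rfl
  have e2 : K * ((1 : Matrix A A ℂ) ⊗ₖ mpow σ ((1 - α) / α)) * K = (K * S) * (S * K) := by
    rw [← hss, ← mpow_mul_mpow hσ hs (by rwa [hss]), one_kronecker_mul]
    simp only [Matrix.mul_assoc, hS]
  have p1 : ((S * K) * (K * S)).IsHermitian := e1 ▸ (sandwich_posSemidef hρ hσ).1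
  have p2 : ((K * S) * (S * K)).IsHermitian := e2 ▸ (sqrt_conj_posSemidef hρ hσ _).1
  rw [e1, e2]
  exact trace_cfc_mul_comm p1 p2 (Real.zero_rpow hα0.ne')

/-- Under the support condition, `σ ^ r` and `σ ^ (-r)` are mutually inverse on the range of the
square root of `ρ`. -/
theorem mpow_mul_mpow_neg_mul_sqrt (hρ : ρ.PosSemidef) (hσ : σ.PosSemidef)
    (h : supp ρ ≤ supp ((1 : Matrix A A ℂ) ⊗ₖ σ)) (r : ℝ) :
    ((1 : Matrix A A ℂ) ⊗ₖ mpow σ r) * (((1 : Matrix A A ℂ) ⊗ₖ mpow σ (-r)) * mpow ρ (1 / 2)) =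
      mpow ρ (1 / 2) := by
  obtain ⟨N, hN⟩ := supp_le_iff.mp h
  rw [← Matrix.mul_assoc, ← one_kronecker_mul]
  set P := (1 : Matrix A A ℂ) ⊗ₖ (mpow σ r * mpow σ (-r))
  have hP : P * ρ = ρ := by
    rw [hN, ← Matrix.mul_assoc, ← one_kronecker_mul, mpow_mul_mpow_neg_mul_self hσ]
  have hK := (mpow_posSemidef hρ (1 / 2)).1
  -- Pρ = ρ passes to the square root K, since (P - 1)K times its adjoint is (P - 1)ρ(P - 1)ᴴ = 0.
  have h0 : (P * mpow ρ (1 / 2) - mpow ρ (1 / 2)) * (P * mpow ρ (1 / 2) - mpow ρ (1 / 2))ᴴ = 0 := by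
    have : P * mpow ρ (1 / 2) - mpow ρ (1 / 2) = (P - 1) * mpow ρ (1 / 2) := by
      rw [Matrix.sub_mul, Matrix.one_mul]
    rw [this, Matrix.conjTranspose_mul, hK.eq, Matrix.mul_assoc, ← Matrix.mul_assoc (mpow ρ _),
      mpow_half_mul_self hρ, ← Matrix.mul_assoc, Matrix.sub_mul, hP, Matrix.one_mul, sub_self,
      Matrix.zero_mul]
  exact sub_eq_zero.mp (Matrix.self_mul_conjTranspose_eq_zero.mp h0)

/-- If Kσ^tK = 0 then σ^tK = 0; as σ^t is invertible on the range of K, K = 0, against Tr ρ = 1.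
Positivity is what lets the logarithm be compared monotonically. -/
theorem trace_mpow_sandwich_pos (hα0 : 0 < α) (hα1 : α ≠ 1) (hρ : IsState ρ) (hσ : σ.PosSemidef)
    (h : supp ρ ≤ supp ((1 : Matrix A A ℂ) ⊗ₖ σ)) : 0 < (mpow (sandwich α ρ σ) α).trace.re := by
  rw [trace_mpow_sandwich hα0 hα1 hρ.1 hσ]
  refine trace_mpow_re_pos (sqrt_conj_posSemidef hρ.1 hσ _) (fun h0 => ?_) α
  have hK := (mpow_posSemidef hρ.1 (1 / 2)).1
  have h1 := mul_eq_zero_of_conj_eq_zero (P := mpow ρ (1 / 2))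
    (one_kronecker_posSemidef (A := A) (mpow_posSemidef hσ ((1 - α) / α))) (by rwa [hK.eq])
  have h2 := mpow_mul_mpow_neg_mul_sqrt hρ.1 hσ h (-((1 - α) / α))
  rw [neg_neg, h1, Matrix.mul_zero] at h2
  have h3 := hρ.2
  rw [← mpow_half_mul_self hρ.1, ← h2] at h3
  simp at h3

/-- Averaging `σ` over a symmetry `U` of `ρ` does not decrease the conditional entropy. -/
theorem condRenyiGiven_le_symmetrized (hα : 1 / 2 ≤ α) (hα1 : α ≠ 1) (hρ : IsState ρ)
    (hσ : σ.PosSemidef) {U : Matrix B B ℂ} (hU : Uᴴ = U) (hUU : U * U = 1)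
    (hUρ : ((1 : Matrix A A ℂ) ⊗ₖ U) * ρ = ρ * ((1 : Matrix A A ℂ) ⊗ₖ U)) :
    condRenyiGiven α ρ σ ≤ condRenyiGiven α ρ ((1 / 2 : ℝ) • (σ + U * σ * U)) := by
  by_cases hsupp : supp ρ ≤ supp ((1 : Matrix A A ℂ) ⊗ₖ σ)
  swap
  · rw [condRenyiGiven, if_neg hsupp]; exact bot_le
  have hα0 : 0 < α := by linarith
  have hσU : (U * σ * U).PosSemidef := by simpa [hU] using hσ.mul_mul_conjTranspose_same U
  set σ' := (1 / 2 : ℝ) • (σ + U * σ * U) with hσ'def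
  have hσ' : σ'.PosSemidef := (hσ.add hσU).smul (by norm_num)
  have hsupp' : supp ρ ≤ supp ((1 : Matrix A A ℂ) ⊗ₖ σ') := by
    obtain ⟨N, hN⟩ := supp_le_iff.mp hsupp
    -- Averaging cannot shrink the support: 2σ' - σ = UσU ≥ 0.
    obtain ⟨N', hN'⟩ := exists_eq_mul_of_le_smul (c := 2) hσ hσ' (by
      have : (2 : ℝ) • σ' - σ = U * σ * U := by rw [hσ'def]; module
      rwa [this])
    refine supp_le_iff.mpr ⟨((1 : Matrix A A ℂ) ⊗ₖ N') * N, ?_⟩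
    rw [← Matrix.mul_assoc, ← one_kronecker_mul, ← hN', ← hN]
  have hpos := trace_mpow_sandwich_pos hα0 hα1 hρ hσ hsupp
  have hpos' := trace_mpow_sandwich_pos hα0 hα1 hρ hσ' hsupp'
  rw [condRenyiGiven, condRenyiGiven, if_pos hsupp, if_pos hsupp', EReal.coe_le_coe_iff]
  rw [trace_mpow_sandwich hα0 hα1 hρ.1 hσ] at hpos ⊢
  rw [trace_mpow_sandwich hα0 hα1 hρ.1 hσ'] at hpos' ⊢
  set t := (1 - α) / α with ht
  set W := (1 : Matrix A A ℂ) ⊗ₖ U with hW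
  set K := mpow ρ (1 / 2)
  have hK : Kᴴ = K := (mpow_posSemidef hρ.1 (1 / 2)).1.eq
  have hWW : W * W = 1 := by rw [hW, ← one_kronecker_mul, hUU, Matrix.one_kronecker_one]
  have hWh : Wᴴ = W := by rw [hW, Matrix.conjTranspose_kronecker, hU, Matrix.conjTranspose_one]
  have hWK : W * K = K * W :=
    (cfc_mul_of_intertwine hρ.1.1 hρ.1.1 hUρ.symm _).symm
  have hkron : ∀ s, (1 : Matrix A A ℂ) ⊗ₖ mpow (U * σ * U) s =
      W * ((1 : Matrix A A ℂ) ⊗ₖ mpow σ s) * W := by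
    intro s
    rw [mpow_conj hU hUU hσ, one_kronecker_mul, one_kronecker_mul]
  set X := K * ((1 : Matrix A A ℂ) ⊗ₖ mpow σ t) * K with hX
  have hXp : X.PosSemidef := sqrt_conj_posSemidef hρ.1 hσ t
  have hXU : K * ((1 : Matrix A A ℂ) ⊗ₖ mpow (U * σ * U) t) * K = W * X * W := by
    rw [hkron, hX]
    calc K * (W * ((1 : Matrix A A ℂ) ⊗ₖ mpow σ t) * W) * K
        = (K * W) * ((1 : Matrix A A ℂ) ⊗ₖ mpow σ t) * (W * K) := by simp only [Matrix.mul_assoc]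
      _ = (W * K) * ((1 : Matrix A A ℂ) ⊗ₖ mpow σ t) * (K * W) := by rw [hWK]
      _ = W * (K * ((1 : Matrix A A ℂ) ⊗ₖ mpow σ t) * K) * W := by simp only [Matrix.mul_assoc]
  have hXUp : (W * X * W).PosSemidef := hXU ▸ sqrt_conj_posSemidef hρ.1 hσU t
  have htr : (mpow (W * X * W) α).trace.re = (mpow X α).trace.re := by
    rw [mpow_conj hWh hWW hXp, Matrix.trace_mul_comm, ← Matrix.mul_assoc, hWW, Matrix.one_mul]
  have hYp := sqrt_conj_posSemidef hρ.1 hσ' t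
  have hconc : ∀ {r : ℝ}, 0 ≤ r → r ≤ 1 → ((1 : Matrix A A ℂ) ⊗ₖ mpow σ' r -
      (1 / 2 : ℝ) • ((1 : Matrix A A ℂ) ⊗ₖ mpow σ r +
        (1 : Matrix A A ℂ) ⊗ₖ mpow (U * σ * U) r)).PosSemidef := by
    intro r h0 h1
    have := one_kronecker_posSemidef (A := A) (mpow_midpoint_concave hσ hσU h0 h1)
    convert this using 1
    rw [sub_eq_add_neg, sub_eq_add_neg, Matrix.kronecker_add, ← neg_one_smul ℂ (_ • _),
      ← neg_one_smul ℂ ((1 / 2 : ℝ) • (mpow σ r + _)), Matrix.kronecker_smul,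
      Matrix.kronecker_smul, Matrix.kronecker_add]
  rcases hα1.lt_or_gt with hlt | hgt
  -- Here t ≤ 1 is exactly α ≥ 1/2.
  · have h1 : 0 ≤ t := div_nonneg (by linarith) hα0.le
    have h2 : t ≤ 1 := by rw [ht, div_le_one hα0]; linarith
    have h3 := (hconc h1 h2).mul_mul_conjTranspose_same K
    rw [hK, Matrix.mul_sub, Matrix.sub_mul, Matrix.mul_smul, Matrix.smul_mul, Matrix.mul_add,
      Matrix.add_mul, hXU] at h3
    have h4 := le_trace_mpow_of_midpoint_le hYp hXp hXUp h3 hα0.le hlt.le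
    rw [htr, add_self_div_two] at h4
    exact mul_le_mul_of_nonneg_left (Real.logb_le_logb_of_le (by norm_num) hpos h4)
      (div_nonneg zero_le_one (by linarith))
  -- Now σ^t inverts the operator concave σ^{-t} on the range of K, hence is convex there; the
  -- negative prefactor reverses the inequality.
  · have ht0 : t < 0 := div_neg_of_neg_of_pos (by linarith) hα0
    have ht1 : -t ≤ 1 := by rw [ht, ← neg_div, div_le_one hα0]; linarith
    have q := fun s : ℝ => one_kronecker_posSemidef (A := A) (mpow_posSemidef hσ s)
    have qU := fun s : ℝ => one_kronecker_posSemidef (A := A) (mpow_posSemidef hσU s)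
    have e1 := mpow_mul_mpow_neg_mul_sqrt hρ.1 hσ hsupp (-t)
    have e3 := mpow_mul_mpow_neg_mul_sqrt hρ.1 hσ' hsupp' (-t)
    rw [neg_neg] at e1 e3
    have e2 : ((1 : Matrix A A ℂ) ⊗ₖ mpow (U * σ * U) (-t)) *
        (((1 : Matrix A A ℂ) ⊗ₖ mpow (U * σ * U) t) * K) = K := by
      rw [hkron, hkron]
      set F := (1 : Matrix A A ℂ) ⊗ₖ mpow σ (-t)
      set G := (1 : Matrix A A ℂ) ⊗ₖ mpow σ t
      calc W * F * W * (W * G * W * K) = W * F * (W * W) * G * (W * K) := by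
            simp only [Matrix.mul_assoc]
        _ = W * (F * (G * K)) * W := by
            rw [hWW, hWK]; simp only [Matrix.mul_assoc, Matrix.one_mul]
        _ = K := by rw [e1, hWK, Matrix.mul_assoc, hWW, Matrix.mul_one]
    have h3 := conj_pseudoinverse_midpoint_convex (q (-t)) (qU (-t)) (q t).1 (qU t).1
      (one_kronecker_posSemidef (mpow_posSemidef hσ' t)).1 e1 e2 e3 (hconc (by linarith) ht1)
    rw [hK, hXU] at h3
    have h4 := trace_mpow_le_of_le_midpoint hYp hXp hXUp h3 hgt.le
    rw [htr, add_self_div_two] at h4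
    exact mul_le_mul_of_nonpos_left (Real.logb_le_logb_of_le (by norm_num) hpos' h4)
      (div_nonpos_of_nonneg_of_nonpos zero_le_one (by linarith))

end Entropy

/-! ### Reduction to σ classical in C -/

section Classical

variable {R C E : Type*} [Fintype R] [DecidableEq R] [Fintype C] [DecidableEq C] [Fintype E]
  [DecidableEq E]

/-- An operator on `C E` is classical in `C` if it commutes with all the basis projections of
`C`. -/
def IsBlockDiag (X : Matrix (C × E) (C × E) ℂ) : Prop :=
  ∀ c, (Matrix.single c c (1 : ℂ) ⊗ₖ (1 : Matrix E E ℂ)) * X =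
    X * (Matrix.single c c (1 : ℂ) ⊗ₖ (1 : Matrix E E ℂ))

theorem isBlockDiag_of_apply_eq_zero {X : Matrix (C × E) (C × E) ℂ}
    (h : ∀ c e c' e', c ≠ c' → X (c, e) (c', e') = 0) : IsBlockDiag X := by
  intro d
  have hd : Matrix.single d d (1 : ℂ) ⊗ₖ (1 : Matrix E E ℂ) =
      Matrix.diagonal fun x : C × E => if x.1 = d then 1 else 0 := by
    ext ⟨c, e⟩ ⟨c', e'⟩
    simp only [Matrix.kroneckerMap_apply, Matrix.single_apply, Matrix.one_apply,
      Matrix.diagonal_apply, Prod.mk.injEq]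
    grind
  rw [hd]
  ext ⟨c, e⟩ ⟨c', e'⟩
  rw [Matrix.diagonal_mul, Matrix.mul_diagonal]
  rcases eq_or_ne c c' with rfl | hc
  · ring
  · simp [h c e c' e' hc]

theorem IsBlockDiag.mpow {X : Matrix (C × E) (C × E) ℂ} (h : IsBlockDiag X)
    (hX : X.PosSemidef) (s : ℝ) : IsBlockDiag (mpow X s) := fun c =>
  (mpow_mul_of_intertwine hX hX (h c).symm s).symm

/-- The optimization over `σ` may be restricted to states which are classical in `C`. -/
theorem exists_isBlockDiag_condRenyiGiven_le {α : ℝ} (hα : 1 / 2 ≤ α) (hα1 : α ≠ 1)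
    {ρ : Matrix (R × C × E) (R × C × E) ℂ} (hρ : IsState ρ) (hρC : IsClassicalIn ρ)
    {σ : Matrix (C × E) (C × E) ℂ} (hσ : IsState σ) :
    ∃ σ' : Matrix (C × E) (C × E) ℂ, IsState σ' ∧ IsBlockDiag σ' ∧
      condRenyiGiven α ρ σ ≤ condRenyiGiven α ρ σ' := by
  -- The values of C are decoupled one at a time; diagonal conjugations preserve zeros already
  -- created.
  suffices H : ∀ F : Finset C, ∃ σ' : Matrix (C × E) (C × E) ℂ, IsState σ' ∧
      (∀ c ∈ F, ∀ e c' e', c ≠ c' → σ' (c, e) (c', e') = 0) ∧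
      condRenyiGiven α ρ σ ≤ condRenyiGiven α ρ σ' by
    obtain ⟨σ', h1, h2, h3⟩ := H Finset.univ
    exact ⟨σ', h1, isBlockDiag_of_apply_eq_zero fun c => h2 c (Finset.mem_univ c), h3⟩
  intro F
  induction F using Finset.induction_on with
  | empty => exact ⟨σ, hσ, by simp, le_rfl⟩
  | insert d F _ ih =>
    obtain ⟨τ, hτ, hτF, hle⟩ := ih
    -- U flips the sign of the block d, so τ and UτU have opposite entries between d and any other
    -- value.
    set u : C × E → ℂ := fun x => if x.1 = d then -1 else 1 with hu
    have huu : ∀ x, u x * u x = 1 := fun x => by simp only [hu]; split_ifs <;> norm_num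
    set U : Matrix (C × E) (C × E) ℂ := Matrix.diagonal u with hUdef
    have hU : Uᴴ = U := by
      rw [hUdef, Matrix.diagonal_conjTranspose]
      congr 1
      funext x
      simp only [hu, Pi.star_apply]
      split_ifs <;> simp
    have hUU : U * U = 1 := by
      rw [hUdef, Matrix.diagonal_mul_diagonal, ← Matrix.diagonal_one]
      congr 1
      funext x
      exact huu x
    have hUρ : ((1 : Matrix R R ℂ) ⊗ₖ U) * ρ = ρ * ((1 : Matrix R R ℂ) ⊗ₖ U) := by
      rw [hUdef, ← Matrix.diagonal_one, Matrix.diagonal_kronecker_diagonal]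
      ext ⟨r, c, e⟩ ⟨r', c', e'⟩
      rw [Matrix.diagonal_mul, Matrix.mul_diagonal]
      rcases eq_or_ne c c' with rfl | hc
      · simp only [hu]; ring
      · simp [hρC r c e r' c' e' hc]
    have hτU : (U * τ * U).PosSemidef := by simpa [hU] using hτ.1.mul_mul_conjTranspose_same U
    have htr : (U * τ * U).trace = 1 := by
      rw [Matrix.trace_mul_comm, ← Matrix.mul_assoc, hUU, Matrix.one_mul, hτ.2]
    refine ⟨(1 / 2 : ℝ) • (τ + U * τ * U), ⟨(hτ.1.add hτU).smul (by norm_num), ?_⟩, ?_,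
      hle.trans (condRenyiGiven_le_symmetrized hα hα1 hρ hτ.1 hU hUU hUρ)⟩
    · rw [Matrix.trace_smul, Matrix.trace_add, htr, hτ.2, Complex.real_smul]
      norm_num
    · intro c hc e c' e' hcc'
      rw [Matrix.smul_apply, Matrix.add_apply, hUdef, Matrix.mul_diagonal, Matrix.diagonal_mul]
      rcases Finset.mem_insert.mp hc with rfl | hcF
      · simp [hu, hcc'.symm]
      · simp [hτF c hcF e c' e' hcc']

theorem condRenyi_eq_iSup_isBlockDiag {α : ℝ} (hα : 1 / 2 ≤ α) (hα1 : α ≠ 1)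
    {ρ : Matrix (R × C × E) (R × C × E) ℂ} (hρ : IsState ρ) (hρC : IsClassicalIn ρ) :
    condRenyi α ρ = ⨆ σ ∈ {σ : Matrix (C × E) (C × E) ℂ | IsState σ ∧ IsBlockDiag σ},
      condRenyiGiven α ρ σ := by
  refine le_antisymm (iSup₂_le fun σ hσ => ?_) (iSup₂_le fun σ hσ => ?_)
  · obtain ⟨σ', h1, h2, h3⟩ := exists_isBlockDiag_condRenyiGiven_le hα hα1 hρ hρC hσ
    exact h3.trans (le_iSup₂ (f := fun σ (_ : σ ∈ {σ : Matrix (C × E) (C × E) ℂ |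
      IsState σ ∧ IsBlockDiag σ}) => condRenyiGiven α ρ σ) σ' ⟨h1, h2⟩)
  · exact le_iSup₂ (f := fun σ (_ : σ ∈ {σ : Matrix (C × E) (C × E) ℂ | IsState σ}) =>
      condRenyiGiven α ρ σ) σ hσ.1

/-! ### Controlled operators and the range of ρ -/

theorem sum_kronecker_single_apply {Z R C E : Type*} [Fintype C] [DecidableEq C]
    [DecidableEq E] (G : C → Matrix Z R ℂ) (z : Z) (c : C) (e : E)
    (r : R) (c' : C) (e' : E) :
    (∑ d, G d ⊗ₖ (Matrix.single d d (1 : ℂ) ⊗ₖ (1 : Matrix E E ℂ))) (z, c, e) (r, c', e') =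
      if c = c' ∧ e = e' then G c z r else 0 := by
  rw [Matrix.sum_apply]
  simp only [Matrix.kroneckerMap_apply, Matrix.single_apply, Matrix.one_apply]
  rw [Finset.sum_eq_single c]
  · grind
  · intro d _ hd
    simp [hd]
  · simp

/-- If each `G c` fixes the range of the `c`-th block of `ρ`, then `∑ c, G c ⊗ |c⟩⟨c| ⊗ 1` fixes
the range of `ρ`. -/
theorem sum_kronecker_single_mul {ρ : Matrix (R × C × E) (R × C × E) ℂ} (hρ : ρ.PosSemidef)
    {G : C → Matrix R R ℂ} (hG : ∀ c, G c * condOp ρ c = condOp ρ c) :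
    (∑ c, G c ⊗ₖ (Matrix.single c c (1 : ℂ) ⊗ₖ (1 : Matrix E E ℂ))) * ρ = ρ := by
  set K := mpow ρ (1 / 2)
  have hK : Kᴴ = K := (mpow_posSemidef hρ (1 / 2)).1.eq
  have hKK : K * Kᴴ = ρ := by rw [hK]; exact mpow_half_mul_self hρ
  -- Moving e into the column index makes `condOp ρ c` the Gram matrix M Mᴴ; then G c fixes M c,
  -- hence the c-th block of rows of K.
  set M : C → Matrix R (E × (R × C × E)) ℂ := fun c => Matrix.of fun r x => K (r, c, x.1) x.2
  have hM : ∀ c, condOp ρ c = M c * (M c)ᴴ := by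
    intro c
    ext r r'
    rw [← hKK]
    simp only [condOp, Matrix.mul_apply, Matrix.conjTranspose_apply, M, Matrix.of_apply]
    rw [Fintype.sum_prod_type]
  have hGM : ∀ c, G c * M c = M c := by
    intro c
    have h := hG c
    rw [hM] at h
    have h0 : (G c * M c - M c) * (G c * M c - M c)ᴴ = 0 := by
      have : G c * M c - M c = (G c - 1) * M c := by rw [Matrix.sub_mul, Matrix.one_mul]
      rw [this, Matrix.conjTranspose_mul, Matrix.mul_assoc, ← Matrix.mul_assoc (M c),
        ← Matrix.mul_assoc, Matrix.sub_mul, h, Matrix.one_mul, sub_self, Matrix.zero_mul]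
    exact sub_eq_zero.mp (Matrix.self_mul_conjTranspose_eq_zero.mp h0)
  have hQK : (∑ c, G c ⊗ₖ (Matrix.single c c (1 : ℂ) ⊗ₖ (1 : Matrix E E ℂ))) * K = K := by
    ext ⟨r, c, e⟩ j
    have h := congrFun (congrFun (hGM c) r) (e, j)
    rw [Matrix.mul_apply] at h ⊢
    simp only [M, Matrix.of_apply] at h
    rw [← h, Fintype.sum_prod_type]
    refine Finset.sum_congr rfl fun r' _ => ?_
    rw [Fintype.sum_prod_type, Finset.sum_eq_single c, Finset.sum_eq_single e]
    · simp [sum_kronecker_single_apply]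
    · intro e' _ he
      simp [sum_kronecker_single_apply, he.symm]
    · simp
    · intro c' _ hc
      simp [sum_kronecker_single_apply, hc.symm]
    · simp
  rw [← hKK, ← Matrix.mul_assoc, hQK]

/-- Covers the values c of probability 0, on which the support hypothesis is silent: a positive
operator of trace 0 vanishes. -/
theorem condOp_eq_zero_of_prob_eq_zero {R C E : Type*} [Fintype R] [Fintype E]
    {ρ : Matrix (R × C × E) (R × C × E) ℂ}
    (hρ : ρ.PosSemidef) {c : C} (h : prob ρ c = 0) : condOp ρ c = 0 := by
  have hp : (condOp ρ c).PosSemidef := by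
    have : condOp ρ c = ∑ e, ρ.submatrix (fun r => (r, c, e)) (fun r => (r, c, e)) := by
      ext r r'
      simp [condOp, Matrix.sum_apply]
    rw [this]
    exact Matrix.posSemidef_sum _ fun e _ => hρ.submatrix _
  exact hp.trace_eq_zero_iff.mp h

/-! ### Invariance under the controlled isometry -/

section Isometry

variable {Z : Type*} [Fintype Z]

/-- `Wᴴ W` fixes the vectors in the domain `S` of the isometry with matrix `W`. -/
theorem isoMatrix_conjTranspose_mul_self_mul
    {S : Submodule ℂ (EuclideanSpace ℂ R)}
    (V : S →ₗᵢ[ℂ] EuclideanSpace ℂ Z) {M : Matrix R R ℂ} (hM : supp M ≤ S) :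
    (isoMatrix V)ᴴ * isoMatrix V * M = M := by
  classical
  have hlin : Matrix.toEuclideanLin (isoMatrix V) =
      V.toLinearMap ∘ₗ S.orthogonalProjectionOnto.toLinearMap :=
    LinearEquiv.apply_symm_apply _ _
  apply Matrix.toEuclideanLin.injective
  ext1 x
  -- Tested against y: ⟨Wy, WMx⟩ equals the inner product of the projections to S, which is ⟨y, Mx⟩
  -- because Mx lies in S.
  apply ext_inner_left ℂ
  intro y
  have hx : Matrix.toEuclideanLin M x ∈ S := hM (LinearMap.mem_range_self _ x)
  have e1 : Matrix.toEuclideanLin ((isoMatrix V)ᴴ * isoMatrix V * M) x =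
      (Matrix.toEuclideanLin (isoMatrix V)).adjoint
        (Matrix.toEuclideanLin (isoMatrix V) (Matrix.toEuclideanLin M x)) := by
    rw [← Matrix.toEuclideanLin_conjTranspose_eq_adjoint]
    simp [Matrix.toLpLin_apply, Matrix.mulVec_mulVec, Matrix.mul_assoc]
  rw [e1, LinearMap.adjoint_inner_right, hlin]
  have e2 := LinearIsometry.inner_map_map (𝕜 := ℂ) (E := S) (E' := EuclideanSpace ℂ Z) V
    (S.orthogonalProjectionOnto y) (S.orthogonalProjectionOnto (Matrix.toEuclideanLin M x))
  refine e2.trans ?_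
  rw [Submodule.inner_orthogonalProjectionOnto_eq_of_mem_right,
    Submodule.orthogonalProjectionOnto_mem_subspace_eq_self (⟨_, hx⟩ : S)]

variable {S : C → Submodule ℂ (EuclideanSpace ℂ R)}
  (V : ∀ c, S c →ₗᵢ[ℂ] EuclideanSpace ℂ Z)

/-- Each projection |c⟩⟨c| ⊗ 1 commutes with X: this is the gain from restricting to block-diagonal
σ. -/
theorem controlled_mul_one_kronecker [DecidableEq Z] {X : Matrix (C × E) (C × E) ℂ} (hX : IsBlockDiag X) :
    controlled (E := E) V * ((1 : Matrix R R ℂ) ⊗ₖ X) =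
      ((1 : Matrix Z Z ℂ) ⊗ₖ X) * controlled (E := E) V := by
  rw [controlled, Matrix.sum_mul, Matrix.mul_sum]
  refine Finset.sum_congr rfl fun c _ => ?_
  rw [← Matrix.mul_kronecker_mul, ← Matrix.mul_kronecker_mul, hX c, Matrix.mul_one, Matrix.one_mul]

theorem controlled_conjTranspose_mul_self :
    (controlled (E := E) V)ᴴ * controlled (E := E) V =
      ∑ c, ((isoMatrix (V c))ᴴ * isoMatrix (V c)) ⊗ₖ
        (Matrix.single c c (1 : ℂ) ⊗ₖ (1 : Matrix E E ℂ)) := by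
  simp only [controlled, Matrix.conjTranspose_sum, Matrix.sum_mul]
  refine Finset.sum_congr rfl fun c _ => ?_
  rw [Matrix.mul_sum, Finset.sum_eq_single c]
  · rw [Matrix.conjTranspose_kronecker, Matrix.conjTranspose_kronecker, ← Matrix.mul_kronecker_mul,
      ← Matrix.mul_kronecker_mul]
    simp
  · intro d _ hd
    rw [Matrix.conjTranspose_kronecker, Matrix.conjTranspose_kronecker, ← Matrix.mul_kronecker_mul,
      ← Matrix.mul_kronecker_mul]
    simp [hd.symm]
  · simp

theorem controlled_conjTranspose_mul_self_mul {ρ : Matrix (R × C × E) (R × C × E) ℂ}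
    (hρ : ρ.PosSemidef) (hS : ∀ c, prob ρ c ≠ 0 → supp (condState ρ c) ≤ S c) :
    (controlled (E := E) V)ᴴ * controlled (E := E) V * ρ = ρ := by
  rw [controlled_conjTranspose_mul_self]
  refine sum_kronecker_single_mul hρ fun c => ?_
  by_cases hc : prob ρ c = 0
  · rw [condOp_eq_zero_of_prob_eq_zero hρ hc, Matrix.mul_zero]
  · have h := isoMatrix_conjTranspose_mul_self_mul (V c) (hS c hc)
    rw [condState, Matrix.mul_smul] at h
    exact smul_right_injective _ (inv_ne_zero hc) h

/-- W moves past `1 ⊗ σ^s`, so the sandwich Y becomes W(YWᴴ), whose traced power equals that of YWᴴW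
= Y. Conjugating the factor N by W or Wᴴ transports the support condition both ways. -/
theorem condRenyiGiven_controlled_conj [DecidableEq Z] {α : ℝ} (hα0 : 0 < α)
    {ρ : Matrix (R × C × E) (R × C × E) ℂ} (hρ : ρ.PosSemidef)
    (hV : (controlled (E := E) V)ᴴ * controlled (E := E) V * ρ = ρ)
    {σ : Matrix (C × E) (C × E) ℂ} (hσ : σ.PosSemidef) (hσC : IsBlockDiag σ) :
    condRenyiGiven α (controlled (E := E) V * ρ * (controlled (E := E) V)ᴴ) σ =
      condRenyiGiven α ρ σ := by
  set W := controlled (E := E) V with hW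
  have hcomm : ∀ {X : Matrix (C × E) (C × E) ℂ}, IsBlockDiag X →
      W * ((1 : Matrix R R ℂ) ⊗ₖ X) = ((1 : Matrix Z Z ℂ) ⊗ₖ X) * W :=
    fun hX => controlled_mul_one_kronecker V hX
  have hcomm' : ∀ {X : Matrix (C × E) (C × E) ℂ}, X.PosSemidef → IsBlockDiag X →
      Wᴴ * ((1 : Matrix Z Z ℂ) ⊗ₖ X) = ((1 : Matrix R R ℂ) ⊗ₖ X) * Wᴴ := by
    intro X hX hXC
    have := congrArg Matrix.conjTranspose (hcomm hXC)
    rw [Matrix.conjTranspose_mul, Matrix.conjTranspose_mul, (one_kronecker_posSemidef hX).1.eq,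
      (one_kronecker_posSemidef hX).1.eq] at this
    exact this.symm
  have hV' : ρ * (Wᴴ * W) = ρ := by
    have := congrArg Matrix.conjTranspose hV
    rwa [Matrix.conjTranspose_mul, Matrix.conjTranspose_mul, Matrix.conjTranspose_conjTranspose,
      hρ.1.eq] at this
  have hsupp : supp (W * ρ * Wᴴ) ≤ supp ((1 : Matrix Z Z ℂ) ⊗ₖ σ) ↔
      supp ρ ≤ supp ((1 : Matrix R R ℂ) ⊗ₖ σ) := by
    rw [supp_le_iff, supp_le_iff]
    constructor
    · rintro ⟨N, hN⟩
      refine ⟨Wᴴ * N * W, ?_⟩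
      calc ρ = Wᴴ * (W * ρ * Wᴴ) * W := by
            simp only [← Matrix.mul_assoc]
            rw [hV, Matrix.mul_assoc, hV']
        _ = _ := by
            rw [hN, ← Matrix.mul_assoc, hcomm' hσ hσC]; simp only [Matrix.mul_assoc]
    · rintro ⟨N, hN⟩
      refine ⟨W * N * Wᴴ, ?_⟩
      rw [hN, ← Matrix.mul_assoc, hcomm hσC]
      simp only [Matrix.mul_assoc]
  have htr : (mpow (sandwich α (W * ρ * Wᴴ) σ) α).trace = (mpow (sandwich α ρ σ) α).trace := by
    have hm := mpow_posSemidef hσ ((1 - α) / (2 * α))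
    have hmC := hσC.mpow hσ ((1 - α) / (2 * α))
    have e1 : sandwich α (W * ρ * Wᴴ) σ = W * (sandwich α ρ σ * Wᴴ) := by
      unfold sandwich
      rw [← Matrix.mul_assoc, ← Matrix.mul_assoc, ← hcomm hmC, Matrix.mul_assoc _ Wᴴ,
        hcomm' hm hmC]
      simp only [Matrix.mul_assoc]
    have e2 : sandwich α ρ σ * Wᴴ * W = sandwich α ρ σ := by
      unfold sandwich
      rw [Matrix.mul_assoc _ _ Wᴴ, ← hcomm' hm hmC, ← Matrix.mul_assoc, Matrix.mul_assoc _ _ W,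
        ← hcomm hmC, ← Matrix.mul_assoc, Matrix.mul_assoc _ Wᴴ W, Matrix.mul_assoc _ ρ, hV']
    rw [e1]
    conv_rhs => rw [← e2]
    refine trace_cfc_mul_comm ?_ ?_ (Real.zero_rpow hα0.ne')
    · rw [← e1]
      exact (sandwich_posSemidef (hρ.mul_mul_conjTranspose_same W) hσ).1
    · rw [e2]
      exact (sandwich_posSemidef hρ hσ).1
  rw [condRenyiGiven, condRenyiGiven, htr]
  by_cases h : supp ρ ≤ supp ((1 : Matrix R R ℂ) ⊗ₖ σ)
  · rw [if_pos h, if_pos (hsupp.mpr h)]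
  · rw [if_neg h, if_neg (hsupp.not.mpr h)]

end Isometry

end Classical

end RenyiInv

theorem mainTheorem4 {R C E : Type*} [Fintype R] [DecidableEq R] [Fintype C] [DecidableEq C]
    [Fintype E] [DecidableEq E] (n : ℕ) (α : ℝ) (hα : 1 / 2 ≤ α) (hα1 : α ≠ 1)
    (ρ : Matrix (R × C × E) (R × C × E) ℂ)
    (ρZ : Matrix (RenyiInv.BitStringLE n × C × E) (RenyiInv.BitStringLE n × C × E) ℂ)
    (hρ : RenyiInv.IsState ρ) (hρZ : RenyiInv.IsState ρZ)
    (hρC : RenyiInv.IsClassicalIn ρ) (hρZC : RenyiInv.IsClassicalIn ρZ)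
    (S : C → Submodule ℂ (EuclideanSpace ℂ R))
    (hS : ∀ c, RenyiInv.prob ρ c ≠ 0 → RenyiInv.supp (RenyiInv.condState ρ c) ≤ S c)
    (V : ∀ c, S c →ₗᵢ[ℂ] EuclideanSpace ℂ (RenyiInv.BitStringLE n))
    (hV : RenyiInv.controlled (E := E) V * ρ * (RenyiInv.controlled (E := E) V)ᴴ = ρZ) :
    RenyiInv.condRenyi α ρZ = RenyiInv.condRenyi α ρ := by
  subst hV
  have hα0 : 0 < α := by linarith
  rw [RenyiInv.condRenyi_eq_iSup_isBlockDiag hα hα1 hρ hρC,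
    RenyiInv.condRenyi_eq_iSup_isBlockDiag hα hα1 hρZ hρZC]
  -- Both suprema now run over the same σ and agree term by term.
  refine iSup_congr fun σ => iSup_congr fun hσ => ?_
  exact RenyiInv.condRenyiGiven_controlled_conj V hα0 hρ.1
    (RenyiInv.controlled_conjTranspose_mul_self_mul V hρ.1 hS) hσ.1.1 hσ.2
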